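/- Definitions. Let $X$ be a set and $\mathcal K\subseteq\mathcal P(X)$. Put $S(X)=\{U^c: U\in\mathcal K\}$ and let $\mathcal C_{\mathcal K}(X)=\{\bigcap\mathcal A:\mathcal A\subseteq S(X)\}$ (with $\bigcap\emptyset=X$). For $Y\subseteq X$, a non-empty family $\mathcal J\subseteq S(X)$ is a $Y$-family if for all $A,B\in\mathcal J$ there are $H\in S(X)$, $C\in\mathcal J$ with $Y\subseteq H$, $A\cap H\subseteq C$ and $B\cap H\subseteq C$. The pair $\langle X,\mathcal K\rangle$ is an S-space if, with respect to the topology generated by $\mathcal K$: (S1) $X$ is $T_0$ and $X=\bigcup\mathcal K$; (S2) the members of $\mathcal K$ are compact, $\mathcal K$ is closed under finite unions and $\emptyset\in\mathcal K$; (S3) if $x\in U\cap V$ with $U,V\in\mathcal K$, there are $W,D\in\mathcal K$ with $x\notin W$, $x\in D$ and $D\subseteq (U\cap V)\cup W$; (S4) if $Y\in\mathcal C_{\mathcal K}(X)$ and $\mathcal J$ is a $Y$-family with $Y\cap A^c\ne\emptyset$ for all $A\in\mathcal J$, then $Y\cap\bigcap\{A^c:A\in\mathcal J\}\neq\emptyset$.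 Then $\mathbf S(X)=\langle S(X),\cap,X\rangle$ is a meet-semilattice with greatest element. Let $\mathcal Z(X)$ be the set of subbasic saturated sets, i.e. intersections of non-empty, dually directed (with respect to $\subseteq$) families $\mathcal L\subseteq\mathcal K$, and let $L_U=\{Z\in\mathcal Z(X): Z\cap U\ne\emptyset\}$. For $R\subseteq X\times\mathcal Z(X)$ put $m_R(U)=\{x: R(x)\subseteq L_U\}$; $\langle X,\mathcal K,R\rangle$ is an mS-space if $m_R(U)\in S(X)$ for all $U\in S(X)$ and $R(x)=\bigcap\{L_U: U\in S(X),\,x\in m_R(U)\}$ for all $x$ (an empty intersection being $\mathcal Z(X)$). An SLata-space is a structure $\langle X,\mathcal K,I,E\rangle$ such that (A1) $\langle X,\mathcal K,I\rangle$ and $\langle X,\mathcal K,E\rangle$ are mS-spaces, and for all $U\in S(X)$ and $x\in X$: (A2) if $x\in U$, then for every $Z\in E(x)$ there is $w\in Z$ with $I(w)\subseteq L_U$; (A3) if for every $Z\in I(x)$ there is $y\in Z$ with $E(y)\subseteq L_U$, then $x\in U$. For $T\subseteq X\times X$ put $\Box_T(U)=\{x: T(x)\subseteq U\}$. A RelS-space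 is a structure $\langle X,\mathcal K,T\rangle$ with $\langle X,\mathcal K\rangle$ an S-space and $T\subseteq X\times X$ such that, for every $U\in S(X)$, $\Box_T(U)\in S(X)$ and $\Box_T^*(U):=\bigcap\{V\in S(X): U\subseteq\Box_T(V)\}\in S(X)$. For a meet-semilattice $\mathbf A$ with greatest element let $\mathcal X(\mathbf A)$ be its set of irreducible filters (proper filters $F$ such that $F=F_1\cap F_2$ with $F_1,F_2$ filters implies $F=F_1$ or $F=F_2$), $\beta(a)=\{P\in\mathcal X(\mathbf A): a\in P\}$ and $\mathcal K_{\mathbf A}=\{\beta(a)^c: a\in A\}$; for a monotone $m:A\to A$, $P\in\mathcal X(\mathbf A)$ and $Z$ subbasic saturated with respect to $\mathcal K_{\mathbf A}$, let $(P,Z)\in R_m$ iff there is no $a\in A$ with $m(a)\in P$ and $\beta(a)\cap Z=\emptyset$. Let $H_X:X\to\mathcal X(\mathbf S(X))$, $H_X(x)=\{U\in S(X): x\in U\}$. For a RelS-space define $R_T\subseteq X\times\mathcal Z(X)$ by $(x,Z)\in R_T$ iff $(H_X(x),H_X[Z])\in R_{\Box_T}$. For $G\subseteq X\times\mathcal C_{\mathcal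 K}(X)$ put $m_G(U)=\{x:\exists Y\in G(x),\ Y\subseteq U\}$ and $D_U=\{Y\in\mathcal C_{\mathcal K}(X): Y\subseteq U\}$; $\langle X,\mathcal K,G\rangle$ is a $\sigma$mS-space if $m_G(U)\in S(X)$ for all $U\in S(X)$ and $G(x)=\bigcap\{(D_U)^c: U\in S(X),\,x\notin m_G(U)\}$ for all $x$ (complements and empty intersection taken in $\mathcal C_{\mathcal K}(X)$). Define $R_G\subseteq X\times\mathcal Z(X)$ by $(x,Z)\in R_G$ iff $Y\cap Z\neq\emptyset$ for all $Y\in G(x)$, and $G_T\subseteq X\times\mathcal C_{\mathcal K}(X)$ by $(x,Y)\in G_T$ iff $x\in\bigcap\{U\in S(X): Y\subseteq\Box_T(U)\}$. Theorem. Let $\langle X,\mathcal K,T\rangle$ be a RelS-space. Then $\langle X,\mathcal K,R_{G_T},R_T\rangle$ is an SLata-space. Moreover, $\langle X,\mathcal K,G_T\rangle$ is a $\sigma$mS-space, $m_{G_T}=\Box_T^*$ on $S(X)$, and $m_{G_T}$ is left adjoint to $\Box_T$ on $S(X)$, i.e. $m_{G_T}(U)\subseteq V$ if and only if $U\subseteq\Box_T(V)$,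 for all $U,V\in S(X)$. -/

import Mathlib

/-- `Z` is a subbasic saturated subset with respect to the subbase `K`: the intersection of a
non-empty subfamily of `K` that is dually directed with respect to inclusion. -/
def IsSubbasicSaturated {X : Type*} (K : Set (Set X)) (Z : Set X) : Prop :=
  ∃ L : Set (Set X), L ⊆ K ∧ L.Nonempty ∧ DirectedOn (fun U V => V ⊆ U) L ∧ Z = ⋂₀ L

/-- `□_T(U) = {x | T(x) ⊆ U}`. -/
def box {X Y : Type*} (T : X → Y → Prop) (U : Set Y) : Set X :=
  {x | {y | T x y} ⊆ U}

/-! ### Semilattices: irreducible filters and the multirelation of a unary operation -/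

/-- Irreducible filters: proper filters `F` such that `F = F₁ ∩ F₂` implies `F = F₁` or `F = F₂`.
In a meet-semilattice with top, the elements of `Order.PFilter A` are exactly the upsets that
contain `⊤` and are closed under `⊓`. -/
def IrrFilter (A : Type*) [SemilatticeInf A] [OrderTop A] : Type _ :=
  {F : Order.PFilter A // (F : Set A) ≠ Set.univ ∧
    ∀ F₁ F₂ : Order.PFilter A, (F : Set A) = (F₁ : Set A) ∩ (F₂ : Set A) → F = F₁ ∨ F = F₂}

/-- `β(a) = {P | a ∈ P}`. -/
def beta {A : Type*} [SemilatticeInf A] [OrderTop A] (a : A) : Set (IrrFilter A) :=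
  {P | a ∈ P.1}

/-- The canonical subbase `{β(a)ᶜ | a ∈ A}` on the irreducible filters of `A`. -/
def canonicalSubbase (A : Type*) [SemilatticeInf A] [OrderTop A] : Set (Set (IrrFilter A)) :=
  {W | ∃ a : A, W = (beta a)ᶜ}

/-- `I_A(Z) = {a | β(a) ∩ Z = ∅}`. -/
def idealOf {A : Type*} [SemilatticeInf A] [OrderTop A] (Z : Set (IrrFilter A)) : Set A :=
  {a | beta a ∩ Z = ∅}

/-- The multirelation `R_m` of an operation `m` on `A`: `(P, Z) ∈ R_m` iff `Z` is subbasic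
saturated and `m⁻¹[P] ∩ I_A(Z) = ∅`. -/
def multiOfOp {A : Type*} [SemilatticeInf A] [OrderTop A] (m : A → A) (P : IrrFilter A) :
    Set (Set (IrrFilter A)) :=
  {Z | IsSubbasicSaturated (canonicalSubbase A) Z ∧ m ⁻¹' (P.1 : Set A) ∩ idealOf Z = ∅}

/-! ### S-spaces -/

/-- An S-space on `X`, with subbase `K`; the topology is the one generated by `K`.
In `S4`, the first three hypotheses on `Y` and `J` say that `Y` is an intersection of
complements of members of `K`, and that `J` is a (non-empty) `Y`-family. -/
structure SSpace (X : Type*) where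
  K : Set (Set X)
  t0 : @T0Space X (TopologicalSpace.generateFrom K)
  cover : ⋃₀ K = Set.univ
  compact : ∀ U ∈ K, @IsCompact X (TopologicalSpace.generateFrom K) U
  union_mem : ∀ U ∈ K, ∀ V ∈ K, U ∪ V ∈ K
  empty_mem : ∅ ∈ K
  S3 : ∀ x : X, ∀ U ∈ K, ∀ V ∈ K, x ∈ U ∩ V →
    ∃ W ∈ K, ∃ D ∈ K, x ∉ W ∧ x ∈ D ∧ D ⊆ (U ∩ V) ∪ W
  S4 : ∀ (Y : Set X) (J : Set (Set X)),
    (∃ B : Set (Set X), (∀ A ∈ B, Aᶜ ∈ K) ∧ Y = ⋂₀ B) →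
    ((∀ A ∈ J, Aᶜ ∈ K) ∧ J.Nonempty) →
    (∀ A ∈ J, ∀ B ∈ J, ∃ H : Set X, ∃ C ∈ J, Hᶜ ∈ K ∧ Y ⊆ H ∧ A ∩ H ⊆ C ∧ B ∩ H ⊆ C) →
    (∀ A ∈ J, (Y ∩ Aᶜ).Nonempty) →
    (Y ∩ ⋂ A ∈ J, Aᶜ).Nonempty

namespace SSpace

variable {X : Type*}

/-- `S(X)`, the complements of the members of the subbase. -/
def S (𝕏 : SSpace X) : Set (Set X) := {U | Uᶜ ∈ 𝕏.K}

/-- `C_K(X)`, the closure system generated by `S(X)`. -/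
def C (𝕏 : SSpace X) : Set (Set X) := {Y | ∃ B ⊆ 𝕏.S, Y = ⋂₀ B}

/-- `Z(X)`, the subbasic saturated subsets. -/
def Z (𝕏 : SSpace X) : Set (Set X) := {Z | IsSubbasicSaturated 𝕏.K Z}

theorem inter_mem (𝕏 : SSpace X) {U V : Set X} (hU : U ∈ 𝕏.S) (hV : V ∈ 𝕏.S) :
    U ∩ V ∈ 𝕏.S := by
  change (U ∩ V)ᶜ ∈ 𝕏.K
  rw [Set.compl_inter]
  exact 𝕏.union_mem _ hU _ hV

theorem univ_mem (𝕏 : SSpace X) : Set.univ ∈ 𝕏.S := by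
  change (Set.univ : Set X)ᶜ ∈ 𝕏.K
  rw [Set.compl_univ]
  exact 𝕏.empty_mem

/-- The semilattice `⟨S(X), ∩, X⟩`. -/
instance (𝕏 : SSpace X) : SemilatticeInf 𝕏.S :=
  Subtype.semilatticeInf fun _ _ hU hV => 𝕏.inter_mem hU hV

instance (𝕏 : SSpace X) : OrderTop 𝕏.S :=
  Subtype.orderTop 𝕏.univ_mem

/-- The filter `{U ∈ S(X) | x ∈ U}`. -/
def filterAt (𝕏 : SSpace X) (x : X) : Order.PFilter 𝕏.S :=
  Order.IsPFilter.toPFilter (F := {U : 𝕏.S | x ∈ U.1}) <| by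
    refine Order.IsPFilter.of_def ⟨⊤, Set.mem_univ x⟩ ?_ ?_
    · intro U hU V hV
      exact ⟨U ⊓ V, ⟨hU, hV⟩, inf_le_left, inf_le_right⟩
    · intro U V hUV hU
      exact hUV hU

theorem mem_filterAt (𝕏 : SSpace X) (x : X) (U : 𝕏.S) : U ∈ 𝕏.filterAt x ↔ x ∈ U.1 :=
  Iff.rfl

theorem filterAt_irreducible (𝕏 : SSpace X) (x : X) :
    (𝕏.filterAt x : Set 𝕏.S) ≠ Set.univ ∧ ∀ F₁ F₂ : Order.PFilter 𝕏.S,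
      (𝕏.filterAt x : Set 𝕏.S) = (F₁ : Set 𝕏.S) ∩ (F₂ : Set 𝕏.S) →
        𝕏.filterAt x = F₁ ∨ 𝕏.filterAt x = F₂ := by
  constructor
  · intro h
    have hx : x ∈ ⋃₀ 𝕏.K := by rw [𝕏.cover]; trivial
    obtain ⟨U, hU, hxU⟩ := hx
    have hm : (⟨Uᶜ, by simpa [S] using hU⟩ : 𝕏.S) ∈ (𝕏.filterAt x : Set 𝕏.S) := by
      rw [h]; trivial
    exact hm hxU
  · intro F₁ F₂ h
    have hmem : ∀ U : 𝕏.S, x ∈ U.1 ↔ U ∈ F₁ ∧ U ∈ F₂ := fun U => by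
      have := congrArg (fun s : Set 𝕏.S => U ∈ s) h
      exact iff_of_eq this
    by_contra hne
    push Not at hne
    obtain ⟨h1, h2⟩ := hne
    have ex : ∀ F : Order.PFilter 𝕏.S, 𝕏.filterAt x ≠ F → (∀ U : 𝕏.S, x ∈ U.1 → U ∈ F) →
        ∃ U ∈ F, x ∉ U.1 := by
      intro F hF hle
      by_contra hcon
      push Not at hcon
      exact hF (SetLike.ext fun U => ⟨hle U, hcon U⟩)
    obtain ⟨U, hU, hxU⟩ := ex F₁ h1 fun U hx => ((hmem U).1 hx).1
    obtain ⟨V, hV, hxV⟩ := ex F₂ h2 fun U hx => ((hmem U).1 hx).2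
    obtain ⟨W, hW, D, hD, hxW, hxD, hsub⟩ := 𝕏.S3 x _ U.2 _ V.2 ⟨hxU, hxV⟩
    let W' : 𝕏.S := ⟨Wᶜ, by simpa [S] using hW⟩
    let D' : 𝕏.S := ⟨Dᶜ, by simpa [S] using hD⟩
    have hW' := (hmem W').1 hxW
    have hD1 : D' ∈ F₁ := by
      refine Order.PFilter.mem_of_le (x := U ⊓ W') ?_ (Order.PFilter.inf_mem hU hW'.1)
      rintro y ⟨hyU, hyW⟩ hyD
      rcases hsub hyD with h | h
      · exact h.1 hyU
      · exact hyW h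
    have hD2 : D' ∈ F₂ := by
      refine Order.PFilter.mem_of_le (x := V ⊓ W') ?_ (Order.PFilter.inf_mem hV hW'.2)
      rintro y ⟨hyV, hyW⟩ hyD
      rcases hsub hyD with h | h
      · exact h.2 hyV
      · exact hyW h
    exact (hmem D').2 ⟨hD1, hD2⟩ hxD

/-- The map `H_X` from `X` to the irreducible filters of `S(X)`, `H_X(x) = {U ∈ S(X) | x ∈ U}`. -/
def H (𝕏 : SSpace X) (x : X) : IrrFilter 𝕏.S :=
  ⟨𝕏.filterAt x, 𝕏.filterAt_irreducible x⟩

/-! ### mS-spaces and SLata-spaces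

A multirelation `R` is given by the sets `R(x)` of subsets of `X`. -/

/-- `L_U`, the subbasic saturated sets that meet `U`. -/
def L (𝕏 : SSpace X) (U : Set X) : Set (Set X) := {Z ∈ 𝕏.Z | (Z ∩ U).Nonempty}

/-- `m_R(U) = {x | R(x) ⊆ L_U}`. -/
def mR (𝕏 : SSpace X) (R : X → Set (Set X)) (U : Set X) : Set X := {x | R x ⊆ 𝕏.L U}

/-- `⟨X, K, R⟩` is an mS-space. The intersection in `m2` is taken inside `Z(X)`. -/
structure IsMSSpace (𝕏 : SSpace X) (R : X → Set (Set X)) : Prop where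
  subset : ∀ x, R x ⊆ 𝕏.Z
  m1 : ∀ U ∈ 𝕏.S, 𝕏.mR R U ∈ 𝕏.S
  m2 : ∀ x, R x = 𝕏.Z ∩ ⋂ U ∈ {U | U ∈ 𝕏.S ∧ x ∈ 𝕏.mR R U}, 𝕏.L U

/-- `⟨X, K, I, E⟩` is an SLata-space. -/
structure IsSLataSpace (𝕏 : SSpace X) (I E : X → Set (Set X)) : Prop where
  left : 𝕏.IsMSSpace I
  right : 𝕏.IsMSSpace E
  A2 : ∀ U ∈ 𝕏.S, ∀ x ∈ U, ∀ Z ∈ E x, ∃ w ∈ Z, I w ⊆ 𝕏.L U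
  A3 : ∀ U ∈ 𝕏.S, ∀ x, (∀ Z ∈ I x, ∃ y ∈ Z, E y ⊆ 𝕏.L U) → x ∈ U

/-! ### RelS-spaces -/

/-- `F_U^T = {V ∈ S(X) | U ⊆ □_T(V)}`. -/
def F (𝕏 : SSpace X) (T : X → X → Prop) (U : Set X) : Set (Set X) := {V ∈ 𝕏.S | U ⊆ box T V}

/-- `T` is an A-relation on the S-space, that is, `⟨X, K, T⟩` is a RelS-space. -/
structure IsARelation (𝕏 : SSpace X) (T : X → X → Prop) : Prop where
  box_mem : ∀ U ∈ 𝕏.S, box T U ∈ 𝕏.S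
  sInter_mem : ∀ U ∈ 𝕏.S, ⋂₀ 𝕏.F T U ∈ 𝕏.S

/-- The operator `□_T` on `S(X)`. -/
def boxOp (𝕏 : SSpace X) (T : X → X → Prop) (hT : ∀ U ∈ 𝕏.S, box T U ∈ 𝕏.S) (U : 𝕏.S) : 𝕏.S :=
  ⟨box T U.1, hT U.1 U.2⟩

/-- The operator `□_T^*(U) = ⋂ F_U^T` on `S(X)`. -/
def boxStarOp (𝕏 : SSpace X) (T : X → X → Prop) (hT : 𝕏.IsARelation T) (U : 𝕏.S) : 𝕏.S :=
  ⟨⋂₀ 𝕏.F T U.1, hT.sInter_mem U.1 U.2⟩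

/-- The multirelation `R_T`: `(x, Z) ∈ R_T` iff `(H_X(x), H_X[Z]) ∈ R_{□_T}`, for `Z ∈ Z(X)`. -/
def RT (𝕏 : SSpace X) (T : X → X → Prop) (hT : ∀ U ∈ 𝕏.S, box T U ∈ 𝕏.S) (x : X) :
    Set (Set X) :=
  {Z ∈ 𝕏.Z | 𝕏.H '' Z ∈ multiOfOp (𝕏.boxOp T hT) (𝕏.H x)}

/-! ### σmS-spaces -/

/-- `D_U = {Y ∈ C_K(X) | Y ⊆ U}`. -/
def D (𝕏 : SSpace X) (U : Set X) : Set (Set X) := {Y ∈ 𝕏.C | Y ⊆ U}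

/-- `m_G(U) = {x | ∃ Y ∈ G(x), Y ⊆ U}`. -/
def mG (G : X → Set (Set X)) (U : Set X) : Set X := {x | ∃ Y ∈ G x, Y ⊆ U}

/-- `⟨X, K, G⟩` is a σmS-space. Complements and the intersection are taken inside `C_K(X)`. -/
structure IsSigmaMSSpace (𝕏 : SSpace X) (G : X → Set (Set X)) : Prop where
  subset : ∀ x, G x ⊆ 𝕏.C
  mem : ∀ U ∈ 𝕏.S, mG G U ∈ 𝕏.S
  eq : ∀ x, G x = 𝕏.C ∩ ⋂ U ∈ {U | U ∈ 𝕏.S ∧ x ∉ mG G U}, 𝕏.C \ 𝕏.D U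

/-- `Ψ_X(𝒟) = {Z ∈ Z(X) | ∀ Y ∈ 𝒟, Y ∩ Z ≠ ∅}`. -/
def Psi (𝕏 : SSpace X) (𝒟 : Set (Set X)) : Set (Set X) := {Z ∈ 𝕏.Z | ∀ Y ∈ 𝒟, (Y ∩ Z).Nonempty}

/-- The multirelation `R_G`: `(x, Z) ∈ R_G` iff `Z ∈ Ψ_X(G(x))`. -/
def RG (𝕏 : SSpace X) (G : X → Set (Set X)) (x : X) : Set (Set X) := 𝕏.Psi (G x)

/-- The relation `G_T` from `X` to `C_K(X)`. -/
def GT (𝕏 : SSpace X) (T : X → X → Prop) (x : X) : Set (Set X) :=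
  {Y ∈ 𝕏.C | x ∈ ⋂ U ∈ {U | U ∈ 𝕏.S ∧ Y ∈ 𝕏.D (box T U)}, U}

end SSpace

/-! On `S(X)` the two multirelations induce a pair of adjoint operators. `R_T` induces `□_T`, and
`R_{G_T}` induces the same operator as `G_T`, namely `□_T^*`. Since `□_T` preserves intersections,
`□_T^*` is its left adjoint; (A2) and (A3) are then the unit `U ⊆ □_T □_T^* U` and the counit `□_T^*
□_T U ⊆ U`. Both inductions are checked by testing with `Z = Uᶜ`, which is subbasic saturated. Two
facts use the S-space axioms: `H` is a bijection onto the irreducible filters, so that `R_T` has a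
description inside `X` (`mem_RT`), and (S4) separates members of `C_K(X)` from disjoint subbasic
saturated sets, so that `R_G` is determined by its operator. -/

/-! ### Irreducible filters -/

/-- The filter generated by a filter `P` and an element `a`. -/
def filterAdjoin {A : Type*} [SemilatticeInf A] [OrderTop A] (P : Order.PFilter A) (a : A) :
    Order.PFilter A :=
  Order.IsPFilter.toPFilter (F := {c : A | ∃ h ∈ P, a ⊓ h ≤ c}) <| by
    refine Order.IsPFilter.of_def ⟨⊤, ⊤, Order.PFilter.top_mem, le_top⟩ ?_ ?_
    · rintro c ⟨h, hh, hc⟩ d ⟨k, hk, hd⟩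
      exact ⟨c ⊓ d, ⟨h ⊓ k, Order.PFilter.inf_mem hh hk,
        le_inf (le_trans (inf_le_inf_left _ inf_le_left) hc)
          (le_trans (inf_le_inf_left _ inf_le_right) hd)⟩, inf_le_left, inf_le_right⟩
    · rintro c d hcd ⟨h, hh, hc⟩
      exact ⟨h, hh, hc.trans hcd⟩

theorem mem_filterAdjoin {A : Type*} [SemilatticeInf A] [OrderTop A] {P : Order.PFilter A}
    {a c : A} : c ∈ filterAdjoin P a ↔ ∃ h ∈ P, a ⊓ h ≤ c :=
  Iff.rfl

/-- Two elements outside an irreducible filter `P` have, modulo a member of `P`, a common upper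
bound outside `P`. -/
theorem IrrFilter.exists_le_of_notMem {A : Type*} [SemilatticeInf A] [OrderTop A]
    (P : IrrFilter A) {a b : A} (ha : a ∉ P.1) (hb : b ∉ P.1) :
    ∃ h ∈ P.1, ∃ c, c ∉ P.1 ∧ a ⊓ h ≤ c ∧ b ⊓ h ≤ c := by
  by_contra hcon
  push Not at hcon
  have self_mem : ∀ d : A, d ∈ filterAdjoin P.1 d := fun d =>
    mem_filterAdjoin.2 ⟨⊤, Order.PFilter.top_mem, inf_le_left⟩
  have le_adjoin : ∀ c ∈ P.1, ∀ d, c ∈ filterAdjoin P.1 d := fun c hc d =>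
    mem_filterAdjoin.2 ⟨c, hc, inf_le_right⟩
  -- Without such a `c`, `P` would be the intersection of the filters generated by adjoining `a` and
  -- `b`, against irreducibility.
  have heq : (P.1 : Set A) = (filterAdjoin P.1 a : Set A) ∩ (filterAdjoin P.1 b : Set A) := by
    ext c
    refine ⟨fun hc => ⟨le_adjoin c hc a, le_adjoin c hc b⟩, ?_⟩
    rintro ⟨⟨h, hh, hc⟩, ⟨k, hk, hd⟩⟩
    by_contra hcP
    exact hcon (h ⊓ k) (Order.PFilter.inf_mem hh hk) c hcP
      (le_trans (inf_le_inf_left _ inf_le_left) hc) (le_trans (inf_le_inf_left _ inf_le_right) hd)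
  rcases P.2.2 _ _ heq with h | h
  · exact ha (by rw [h]; exact self_mem a)
  · exact hb (by rw [h]; exact self_mem b)

namespace SSpace

variable {X : Type*} (𝕏 : SSpace X)

theorem compl_mem_S {U : Set X} (hU : U ∈ 𝕏.K) : Uᶜ ∈ 𝕏.S := by
  change Uᶜᶜ ∈ 𝕏.K
  rwa [compl_compl]

theorem mem_C_of_mem_S {U : Set X} (hU : U ∈ 𝕏.S) : U ∈ 𝕏.C :=
  ⟨{U}, Set.singleton_subset_iff.2 hU, (Set.sInter_singleton U).symm⟩

theorem compl_mem_Z {U : Set X} (hU : U ∈ 𝕏.S) : Uᶜ ∈ 𝕏.Z := by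
  refine ⟨{Uᶜ}, Set.singleton_subset_iff.2 hU, Set.singleton_nonempty _, ?_,
    (Set.sInter_singleton _).symm⟩
  rintro A hA B hB
  rw [Set.mem_singleton_iff] at hA hB
  exact ⟨Uᶜ, rfl, hA.ge, hB.ge⟩

/-! ### The map `H` is a bijection -/

theorem mem_H {x : X} {U : 𝕏.S} : U ∈ (𝕏.H x).1 ↔ x ∈ U.1 :=
  Iff.rfl

theorem H_injective : Function.Injective 𝕏.H := by
  intro x y hxy
  let : TopologicalSpace X := TopologicalSpace.generateFrom 𝕏.K
  have : T0Space X := 𝕏.t0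
  have hiff : ∀ U ∈ 𝕏.K, x ∈ U ↔ y ∈ U := by
    intro U hU
    have h : x ∈ Uᶜ ↔ y ∈ Uᶜ := by
      rw [← 𝕏.mem_H (U := ⟨Uᶜ, 𝕏.compl_mem_S hU⟩), hxy, 𝕏.mem_H]
    exact not_iff_not.1 h
  have hnhds : nhds x = nhds y := by
    rw [TopologicalSpace.nhds_generateFrom, TopologicalSpace.nhds_generateFrom]
    congr! 3 with U
    exact and_congr_left fun hU => hiff U hU
  exact (inseparable_def.2 hnhds).eq

/-- Compactness of `Aᶜ`: finitely many complements of members of `P` cover it, and the meet of those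
members lies in `P` below `A`. -/
theorem mem_of_sInter_subset (P : Order.PFilter 𝕏.S) (A : 𝕏.S)
    (h : ⋂ B ∈ P, (B : Set X) ⊆ A) : A ∈ P := by
  classical
  let : TopologicalSpace X := TopologicalSpace.generateFrom 𝕏.K
  have hcover : (A : Set X)ᶜ ⊆ ⋃ B : {B : 𝕏.S // B ∈ P}, (B.1 : Set X)ᶜ := by
    intro x hx
    by_contra hcon
    simp only [Set.mem_iUnion, not_exists, Set.mem_compl_iff, not_not] at hcon
    exact hx (h (Set.mem_iInter₂.2 fun B hB => hcon ⟨B, hB⟩))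
  obtain ⟨t, ht⟩ := (𝕏.compact _ A.2).elim_finite_subcover
    (fun B : {B : 𝕏.S // B ∈ P} => (B.1 : Set X)ᶜ)
    (fun B => TopologicalSpace.isOpen_generateFrom_of_mem B.1.2) hcover
  have key : ∀ s : Finset {B : 𝕏.S // B ∈ P}, ∃ D ∈ P, ∀ B ∈ s, D ≤ B.1 := by
    intro s
    induction s using Finset.induction_on with
    | empty => exact ⟨⊤, Order.PFilter.top_mem, by simp⟩
    | insert B s _ ih =>
      obtain ⟨D, hD, hDs⟩ := ih
      refine ⟨B.1 ⊓ D, Order.PFilter.inf_mem B.2 hD, fun C hC => ?_⟩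
      rcases Finset.mem_insert.1 hC with rfl | hC
      · exact inf_le_left
      · exact inf_le_right.trans (hDs C hC)
  obtain ⟨D, hD, hDt⟩ := key t
  refine Order.PFilter.mem_of_le (x := D) ?_ hD
  intro x hx
  by_contra hxA
  obtain ⟨B, hB, hxB⟩ := Set.mem_iUnion₂.1 (ht hxA)
  exact hxB (hDt B hB hx)

/-- Apply (S4) to `Y = ⋂ P` and the family `J` of elements outside `P`: a point of `Y` avoiding all
of `J` has filter exactly `P`. Properness makes `J` non-empty, irreducibility makes it a `Y`-family,
and compactness shows that no member of `J` contains `Y`. -/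
theorem H_surjective : Function.Surjective 𝕏.H := by
  intro P
  have h4 := 𝕏.S4 (⋂ B ∈ P.1, (B : Set X)) {A | ∃ h : A ∈ 𝕏.S, (⟨A, h⟩ : 𝕏.S) ∉ P.1}
    ⟨{B | ∃ h : B ∈ 𝕏.S, (⟨B, h⟩ : 𝕏.S) ∈ P.1}, fun A hA => hA.1, by
      ext x
      simp only [Set.mem_iInter, Set.mem_sInter]
      exact ⟨fun hx B hB => hx _ hB.2, fun hx B hB => hx B ⟨B.2, hB⟩⟩⟩
    ⟨fun A hA => hA.1, by
      obtain ⟨A, hA⟩ := (Set.ne_univ_iff_exists_notMem _).1 P.2.1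
      exact ⟨A, A.2, hA⟩⟩
    (by
      rintro A ⟨hA, hAP⟩ B ⟨hB, hBP⟩
      obtain ⟨D, hD, C, hC, hAC, hBC⟩ := P.exists_le_of_notMem hAP hBP
      exact ⟨D, C, ⟨C.2, hC⟩, D.2, Set.biInter_subset_of_mem hD, hAC, hBC⟩)
    (by
      rintro A ⟨hA, hAP⟩
      rw [Set.inter_compl_nonempty_iff]
      exact fun hsub => hAP (𝕏.mem_of_sInter_subset P.1 ⟨A, hA⟩ hsub))
  obtain ⟨x, hxP, hxJ⟩ := h4
  refine ⟨x, Subtype.ext (SetLike.ext fun U => ⟨fun hU => ?_, fun hU => ?_⟩)⟩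
  · by_contra hUP
    exact Set.mem_iInter₂.1 hxJ U.1 ⟨U.2, hUP⟩ hU
  · exact Set.mem_iInter₂.1 hxP U hU

theorem image_H_isSubbasicSaturated {Z : Set X} (hZ : Z ∈ 𝕏.Z) :
    IsSubbasicSaturated (canonicalSubbase 𝕏.S) (𝕏.H '' Z) := by
  obtain ⟨L, hLK, hne, hdir, rfl⟩ := hZ
  refine ⟨(𝕏.H '' ·) '' L, ?_, hne.image _, ?_, ?_⟩
  · rintro _ ⟨U, hU, rfl⟩
    refine ⟨⟨Uᶜ, 𝕏.compl_mem_S (hLK hU)⟩, ?_⟩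
    ext P
    obtain ⟨x, rfl⟩ := 𝕏.H_surjective P
    change 𝕏.H x ∈ 𝕏.H '' U ↔ ¬ x ∈ Uᶜ
    rw [𝕏.H_injective.mem_set_image, Set.notMem_compl_iff]
  · rintro _ ⟨U, hU, rfl⟩ _ ⟨V, hV, rfl⟩
    obtain ⟨W, hW, hWU, hWV⟩ := hdir U hU V hV
    exact ⟨_, ⟨W, hW, rfl⟩, Set.image_mono hWU, Set.image_mono hWV⟩
  · rw [Set.sInter_image, Set.sInter_eq_biInter,
      Set.image_iInter₂ ⟨𝕏.H_injective, 𝕏.H_surjective⟩]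

/-! ### The multirelation `R_T` -/

/-- Bijectivity of `H` makes the saturation condition on `H[Z]` automatic, so irreducible filters
play no role beyond this point. -/
theorem mem_RT {T : X → X → Prop} (hT : ∀ U ∈ 𝕏.S, box T U ∈ 𝕏.S) {x : X} {Z : Set X} :
    Z ∈ 𝕏.RT T hT x ↔ Z ∈ 𝕏.Z ∧ ∀ U ∈ 𝕏.S, x ∈ box T U → (Z ∩ U).Nonempty := by
  refine and_congr_right fun hZ => ⟨fun h U hU hx => ?_, fun h => ?_⟩
  · by_contra hne
    have hmem : (⟨U, hU⟩ : 𝕏.S) ∈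
        𝕏.boxOp T hT ⁻¹' ((𝕏.H x).1 : Set 𝕏.S) ∩ idealOf (𝕏.H '' Z) := by
      refine ⟨hx, Set.eq_empty_iff_forall_notMem.2 ?_⟩
      rintro _ ⟨hU', z, hz, rfl⟩
      exact hne ⟨z, hz, hU'⟩
    rw [h.2] at hmem
    exact hmem
  · refine ⟨𝕏.image_H_isSubbasicSaturated hZ, Set.eq_empty_iff_forall_notMem.2 ?_⟩
    rintro U ⟨hx, hU⟩
    obtain ⟨z, hz, hzU⟩ := h U.1 U.2 hx
    exact Set.eq_empty_iff_forall_notMem.1 hU (𝕏.H z) ⟨hzU, z, hz, rfl⟩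

theorem mR_RT {T : X → X → Prop} (hT : ∀ U ∈ 𝕏.S, box T U ∈ 𝕏.S) {U : Set X} (hU : U ∈ 𝕏.S) :
    𝕏.mR (𝕏.RT T hT) U = box T U := by
  ext x
  refine ⟨fun h => ?_, fun h Z hZ => ⟨hZ.1, ((𝕏.mem_RT hT).1 hZ).2 U hU h⟩⟩
  by_contra hx
  -- If `Uᶜ` missed some `V ⊇ T(x)`, then `T(x) ⊆ V ⊆ U`.
  have hZ : Uᶜ ∈ 𝕏.RT T hT x := by
    refine (𝕏.mem_RT hT).2 ⟨𝕏.compl_mem_Z hU, fun V _ hxV => ?_⟩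
    rw [Set.inter_comm, Set.inter_compl_nonempty_iff]
    exact fun hVU => hx (Set.Subset.trans hxV hVU)
  obtain ⟨z, hz, hz'⟩ := (h hZ).2
  exact hz hz'

theorem isMSSpace_RT {T : X → X → Prop} (hT : ∀ U ∈ 𝕏.S, box T U ∈ 𝕏.S) :
    𝕏.IsMSSpace (𝕏.RT T hT) where
  subset _ _ hZ := hZ.1
  m1 U hU := by rw [𝕏.mR_RT hT hU]; exact hT U hU
  m2 x := by
    refine Set.Subset.antisymm
      (fun Z hZ => ⟨hZ.1, Set.mem_iInter₂.2 fun U hU => hU.2 hZ⟩) ?_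
    rintro Z ⟨hZ, hL⟩
    refine (𝕏.mem_RT hT).2 ⟨hZ, fun U hU hx => ?_⟩
    rw [← 𝕏.mR_RT hT hU] at hx
    exact (Set.mem_iInter₂.1 hL U ⟨hU, hx⟩).2

/-! ### The multirelation `R_G` of a σmS-space -/

variable {𝕏}

/-- A member of `C_K(X)` disjoint from a subbasic saturated set is separated from it by a member
of `S(X)`. -/
theorem exists_mem_S_of_disjoint {Y Z : Set X} (hY : Y ∈ 𝕏.C) (hZ : Z ∈ 𝕏.Z)
    (h : ¬ (Y ∩ Z).Nonempty) : ∃ U ∈ 𝕏.S, Y ⊆ U ∧ ¬ (Z ∩ U).Nonempty := by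
  obtain ⟨L, hLK, hne, hdir, rfl⟩ := hZ
  by_contra hcon
  push Not at hcon
  -- Directedness of `L` gives a `Y`-family already with `H = X`. No `Uᶜ` with `U ∈ L` contains `Y`,
  -- since it would separate `Y` from `⋂ L ⊆ U`; the point given by (S4) then lies in `Y ∩ ⋂ L`.
  have h4 := 𝕏.S4 Y (compl '' L) hY
    ⟨by rintro _ ⟨U, hU, rfl⟩; exact 𝕏.compl_mem_S (hLK hU), hne.image _⟩
    (by
      rintro _ ⟨U, hU, rfl⟩ _ ⟨V, hV, rfl⟩
      obtain ⟨W, hW, hWU, hWV⟩ := hdir U hU V hV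
      exact ⟨Set.univ, _, ⟨W, hW, rfl⟩, 𝕏.univ_mem, Set.subset_univ _,
        Set.inter_subset_left.trans (Set.compl_subset_compl.2 hWU),
        Set.inter_subset_left.trans (Set.compl_subset_compl.2 hWV)⟩)
    (by
      rintro _ ⟨U, hU, rfl⟩
      rw [Set.inter_compl_nonempty_iff]
      intro hYU
      obtain ⟨z, hz, hzU⟩ := hcon _ (𝕏.compl_mem_S (hLK hU)) hYU
      exact hzU (hz U hU))
  obtain ⟨y, hyY, hyJ⟩ := h4
  refine h ⟨y, hyY, fun U hU => ?_⟩
  exact Set.notMem_compl_iff.1 (Set.mem_iInter₂.1 hyJ _ ⟨U, hU, rfl⟩)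

namespace IsSigmaMSSpace

variable {G : X → Set (Set X)}

theorem mem_of_subset_imp (hG : 𝕏.IsSigmaMSSpace G) {x : X} {Y : Set X} (hY : Y ∈ 𝕏.C)
    (h : ∀ U ∈ 𝕏.S, Y ⊆ U → x ∈ mG G U) : Y ∈ G x := by
  rw [hG.eq x]
  exact ⟨hY, Set.mem_iInter₂.2 fun U hU => ⟨hY, fun hYU => hU.2 (h U hU.1 hYU.2)⟩⟩

/-- The closure condition makes `G(x)` upward closed in `C_K(X)`, so `U` itself can serve as
witness. -/
theorem mem_of_mem_mG (hG : 𝕏.IsSigmaMSSpace G) {x : X} {U : Set X} (hU : U ∈ 𝕏.S)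
    (hx : x ∈ mG G U) : U ∈ G x := by
  obtain ⟨Y, hY, hYU⟩ := hx
  exact hG.mem_of_subset_imp (𝕏.mem_C_of_mem_S hU) fun V _ hUV => ⟨Y, hY, hYU.trans hUV⟩

theorem mR_RG (hG : 𝕏.IsSigmaMSSpace G) {U : Set X} (hU : U ∈ 𝕏.S) :
    𝕏.mR (𝕏.RG G) U = mG G U := by
  ext x
  refine ⟨fun h => ?_, fun hx Z hZ => ⟨hZ.1, ?_⟩⟩
  · by_contra hx
    have hZ : Uᶜ ∈ 𝕏.RG G x := by
      refine ⟨𝕏.compl_mem_Z hU, fun Y hY => ?_⟩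
      rw [Set.inter_compl_nonempty_iff]
      exact fun hYU => hx ⟨Y, hY, hYU⟩
    obtain ⟨z, hz, hz'⟩ := (h hZ).2
    exact hz hz'
  · rw [Set.inter_comm]
    exact hZ.2 U (hG.mem_of_mem_mG hU hx)

theorem isMSSpace_RG (hG : 𝕏.IsSigmaMSSpace G) : 𝕏.IsMSSpace (𝕏.RG G) where
  subset _ _ hZ := hZ.1
  m1 U hU := by rw [hG.mR_RG hU]; exact hG.mem U hU
  m2 x := by
    refine Set.Subset.antisymm
      (fun Z hZ => ⟨hZ.1, Set.mem_iInter₂.2 fun U hU => hU.2 hZ⟩) ?_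
    rintro Z ⟨hZ, hL⟩
    refine ⟨hZ, fun Y hY => ?_⟩
    by_contra hdisj
    obtain ⟨U, hU, hYU, hZU⟩ := exists_mem_S_of_disjoint (hG.subset x hY) hZ hdisj
    have hx : x ∈ 𝕏.mR (𝕏.RG G) U := by rw [hG.mR_RG hU]; exact ⟨Y, hY, hYU⟩
    exact hZU (Set.mem_iInter₂.1 hL U ⟨hU, hx⟩).2

end IsSigmaMSSpace

/-! ### The relation `G_T` -/

theorem mem_GT {T : X → X → Prop} {x : X} {Y : Set X} :
    Y ∈ 𝕏.GT T x ↔ Y ∈ 𝕏.C ∧ ∀ U ∈ 𝕏.S, Y ⊆ box T U → x ∈ U :=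
  and_congr_right fun hY =>
    ⟨fun h U hU hYU => Set.mem_iInter₂.1 h U ⟨hU, hY, hYU⟩,
      fun h => Set.mem_iInter₂.2 fun U hU => h U hU.1 hU.2.2⟩

/-- `G_T(x)` is upward closed in `C_K(X)`, so only the largest candidate `Y = U` matters. -/
theorem mG_GT (T : X → X → Prop) {U : Set X} (hU : U ∈ 𝕏.S) :
    mG (𝕏.GT T) U = ⋂₀ 𝕏.F T U := by
  ext x
  constructor
  · rintro ⟨Y, hY, hYU⟩ V ⟨hV, hUV⟩
    exact (mem_GT.1 hY).2 V hV (hYU.trans hUV)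
  · intro hx
    exact ⟨U, mem_GT.2 ⟨𝕏.mem_C_of_mem_S hU, fun V hV hUV => hx V ⟨hV, hUV⟩⟩, subset_rfl⟩

theorem mG_GT_subset {T : X → X → Prop} {U V : Set X} (hV : V ∈ 𝕏.S) (h : U ⊆ box T V) :
    mG (𝕏.GT T) U ⊆ V := by
  rintro x ⟨Y, hY, hYU⟩
  exact (mem_GT.1 hY).2 V hV (hYU.trans h)

theorem subset_box_mG_GT (T : X → X → Prop) {U : Set X} (hU : U ∈ 𝕏.S) :
    U ⊆ box T (mG (𝕏.GT T) U) := by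
  rw [mG_GT T hU]
  intro x hx y hxy V hV
  exact hV.2 hx hxy

theorem mG_GT_subset_iff {T : X → X → Prop} {U V : Set X} (hU : U ∈ 𝕏.S) (hV : V ∈ 𝕏.S) :
    mG (𝕏.GT T) U ⊆ V ↔ U ⊆ box T V :=
  ⟨fun h _ hx => Set.Subset.trans (subset_box_mG_GT T hU hx) h, mG_GT_subset hV⟩

theorem IsARelation.isSigmaMSSpace_GT {T : X → X → Prop} (hT : 𝕏.IsARelation T) :
    𝕏.IsSigmaMSSpace (𝕏.GT T) where
  subset _ _ hY := hY.1
  mem U hU := by rw [mG_GT T hU]; exact hT.sInter_mem U hU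
  eq x := by
    refine Set.Subset.antisymm (fun Y hY => ⟨hY.1, Set.mem_iInter₂.2 fun U hU =>
      ⟨hY.1, fun hYU => hU.2 ⟨Y, hY, hYU.2⟩⟩⟩) ?_
    rintro Y ⟨hY, hD⟩
    refine mem_GT.2 ⟨hY, fun V hV hYV => ?_⟩
    by_contra hx
    have hbox := hT.box_mem V hV
    -- The test set is `□_T(V)`: by the counit, `x ∉ V` excludes `x` from `m_{G_T}(□_T(V))`, yet `Y
    -- ⊆ □_T(V)`.
    exact (Set.mem_iInter₂.1 hD (box T V)
      ⟨hbox, fun h => hx (mG_GT_subset hV subset_rfl h)⟩).2 ⟨hY, hYV⟩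

theorem IsARelation.isSLataSpace {T : X → X → Prop} (hT : 𝕏.IsARelation T) :
    𝕏.IsSLataSpace (𝕏.RG (𝕏.GT T)) (𝕏.RT T hT.box_mem) where
  left := hT.isSigmaMSSpace_GT.isMSSpace_RG
  right := 𝕏.isMSSpace_RT hT.box_mem
  A2 U hU x hx Z hZ := by
    -- By the unit, `x ∈ □_T(m_{G_T}(U))`, so `Z` meets `m_{G_T}(U)`.
    obtain ⟨w, hwZ, hw⟩ := ((𝕏.mem_RT hT.box_mem).1 hZ).2 _ (hT.isSigmaMSSpace_GT.mem U hU)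
      (subset_box_mG_GT T hU hx)
    rw [← hT.isSigmaMSSpace_GT.mR_RG hU] at hw
    exact ⟨w, hwZ, hw⟩
  A3 U hU x h := by
    -- The hypothesis says that every `Z ∈ R_{G_T}(x)` meets `□_T(U)`; the counit then finishes.
    have hx : x ∈ 𝕏.mR (𝕏.RG (𝕏.GT T)) (box T U) := by
      intro Z hZ
      obtain ⟨y, hyZ, hy⟩ := h Z hZ
      refine ⟨hZ.1, y, hyZ, ?_⟩
      rw [← 𝕏.mR_RT hT.box_mem hU]
      exact hy
    rw [hT.isSigmaMSSpace_GT.mR_RG (hT.box_mem U hU)] at hx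
    exact mG_GT_subset hU subset_rfl hx

end SSpace

theorem mainTheorem8 {X : Type*} (𝕏 : SSpace X) (T : X → X → Prop) (hT : 𝕏.IsARelation T) :
    𝕏.IsSLataSpace (𝕏.RG (𝕏.GT T)) (𝕏.RT T hT.box_mem) ∧
    𝕏.IsSigmaMSSpace (𝕏.GT T) ∧
    (∀ U : 𝕏.S, SSpace.mG (𝕏.GT T) (U : Set X) = (𝕏.boxStarOp T hT U : Set X)) ∧
    (∀ U ∈ 𝕏.S, ∀ V ∈ 𝕏.S, SSpace.mG (𝕏.GT T) U ⊆ V ↔ U ⊆ box T V) :=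
  ⟨hT.isSLataSpace, hT.isSigmaMSSpace_GT, fun U => SSpace.mG_GT T U.2,
    fun _ hU _ hV => SSpace.mG_GT_subset_iff hU hV⟩
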